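/- Let $\mathcal E\subseteq\mathbb R^2$ be an environment (every point of $\mathcal E$ is a limit of interior points of $\mathcal E$) with $n$ agents $A_1,\dots,A_n$, where $A_i$ is a disk of radius $r_i>0$ with starting position $s_i$, destination $d_i$ and priority $\rho_i$, $\rho_1\ge\dots\ge\rho_n>0$. Put $\hat r=\max_i r_i$, $\mathcal S=\bigcup_i B(s_i,r_i)$ and $\mathcal D=\bigcup_i B(d_i,r_i)$, where $B(x,r)$ is the closed disk, and let $\mathcal S\cap\mathcal D=\emptyset$. Suppose that in the absence of obstacles all tasks can be carried out without collision along non-overlapping trajectories: there are $T>0$ and continuous $p_i:[0,T]\to\mathbb R^2$ with $p_i(0)=s_i$, $p_i(T)=d_i$, $B(p_i(t),r_i)\subseteq\mathcal E$, $\|p_i(t)-p_j(u)\|\ge r_i+r_j$ for all $i\ne j$ and $t,u\in[0,T]$, having (right) velocities $v_i(t)$, $t\in[0,T)$, with $\hat v=\sup_{i,t}\|v_i(t)\|<\infty$. Let the initial obstacle region $\Delta_0\subseteq\mathcal E\setminus(\mathcal S\cup\mathcal D)$ be closed, with $\mathcal E\setminus(\Delta_0\cup\mathcal S\cup\mathcal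 D)\neq\emptyset$. Let the capacity $c$ of the online environment optimization satisfy $2b\hat r\hat v\le c<2(b+1)\hat r\hat v$ for an integer $1\le b<n$. Here an online environment optimization of capacity $c$ is a family $\Delta(t)\subseteq\mathcal E$, $t\ge0$, of closed sets with $\Delta(0)=\Delta_0$, constant area $|\Delta(t)|=|\Delta_0|$, and $\tfrac12|\Delta(s)\,\triangle\,\Delta(t)|\le c\,(t-s)$ for $0\le s\le t$, where $\triangle$ is the symmetric difference. Let $T_{\max}\in\mathbb R$ be the time within which the agents are required to arrive, and let $n_p$ be the largest $\eta\in\{1,\dots,n\}$ with $$\sum_{j=1}^{\eta}\min\{j,b\}\Big(\frac{T_{\max}\,\rho_\eta}{2T\rho_{\eta+1-j}}-\frac{T_{\max}\,\rho_\eta}{2T\rho_{\eta-j}}\Big)\ge\eta ,$$ where the term with $\rho_0$ (for $j=\eta$) is read as $0$ (it is supposed that such an $\eta$ exists). Then there is an online environment optimization $\Delta(t)$ of capacity $c$, together with motions $q_i$, $i=1,\dots,n$, where $q_i:[0,\infty)\to\mathbb R^2$ follows $p_i$ from $s_i$ on, possibly slowed down and with waiting, but never backwards and never faster than $p_i$ (that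 is, $q_i=p_i\circ\sigma_i$ with $\sigma_i:[0,\infty)\to[0,T]$ non-decreasing and $1$-Lipschitz, $\sigma_i(0)=0$), such that no collisions occur: $\|q_i(t)-q_j(t)\|\ge r_i+r_j$ for $i\neq j$ and $\|q_i(t)-z\|\ge r_i$ for all $z\in\Delta(t)$, at all times $t\ge0$; and each of the $n_p$ agents $A_1,\dots,A_{n_p}$ with the highest priorities reaches its destination at some time $T_i\le T_{\max}$ and stays there. -/

import Mathlib

open MeasureTheory

noncomputable section

/-- The plane, with its Euclidean norm and Lebesgue (area) measure. -/
abbrev Plane : Type := EuclideanSpace ℝ (Fin 2)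

/-- The data of a prioritized navigation problem with `n` agents: the environment, the start
and destination of each agent, the radii of the agent bodies, and the priorities. The agents
`A_1, …, A_n` are indexed by `Fin n`, so that `A_k` has the index `k - 1`. -/
structure AgentSystem (n : ℕ) where
  env : Set Plane
  start : Fin n → Plane
  dest : Fin n → Plane
  radius : Fin n → ℝ
  priority : Fin n → ℝ

namespace AgentSystem

variable {n : ℕ}

/-- The starting region: the union of the agent disks at the starting positions. -/
def startRegion (A : AgentSystem n) : Set Plane :=
  ⋃ i, Metric.closedBall (A.start i) (A.radius i)

/-- The destination region: the union of the agent disks at the destinations. -/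
def destRegion (A : AgentSystem n) : Set Plane :=
  ⋃ i, Metric.closedBall (A.dest i) (A.radius i)

/-- The maximal agent radius. -/
def maxRadius (A : AgentSystem n) : ℝ := ⨆ i, A.radius i

/-- The standing conventions: the environment is a genuinely two-dimensional region (each of
its points is a limit of interior points), the radii and the priorities are positive, the
agents are ordered by decreasing priority, and the starting and destination regions
do not overlap. -/
structure WellPosed (A : AgentSystem n) : Prop where
  env_regular : A.env ⊆ closure (interior A.env)
  radius_pos : ∀ i, 0 < A.radius i
  priority_pos : ∀ i, 0 < A.priority i
  priority_antitone : Antitone A.priority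
  disjoint_regions : Disjoint A.startRegion A.destRegion

/-- `1 / ρ_k` for `1 ≤ k ≤ n`, with the convention that it is `0` for `k = 0`
(the navigation time allotted to "no agent" is zero). -/
def invPriority (A : AgentSystem n) (k : ℕ) : ℝ :=
  if h : 1 ≤ k ∧ k ≤ n then 1 / A.priority ⟨k - 1, by omega⟩ else 0

/-- `ρ_k` for `1 ≤ k ≤ n` (and `0` for the other, unused, values of `k`). -/
def priorityAt (A : AgentSystem n) (k : ℕ) : ℝ :=
  if h : 1 ≤ k ∧ k ≤ n then A.priority ⟨k - 1, by omega⟩ else 0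

/-- The inequality
`∑_{j=1}^{η} min{j, b} (Tmax ρ_η / (2 T ρ_{η+1-j}) - Tmax ρ_η / (2 T ρ_{η-j})) ≥ η`,
where the term with `ρ_0` is read as `0`. -/
def DeadlineCondition (A : AgentSystem n) (b : ℕ) (T Tmax : ℝ) (η : ℕ) : Prop :=
  (η : ℝ) ≤ ∑ j ∈ Finset.Icc 1 η, ((min j b : ℕ) : ℝ) *
    (Tmax * A.priorityAt η / (2 * T) * A.invPriority (η + 1 - j)
      - Tmax * A.priorityAt η / (2 * T) * A.invPriority (η - j))

/-- Trajectories `p i : [0, T] → ℝ²` that solve all navigation tasks in the environment without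
obstacles and do not overlap. Only the values on `[0, T]` matter. The velocity `v i t` is the
right derivative, so that trajectories with corners (polygonal paths, say) are allowed.
`non_overlap` says that the regions swept by two different agents do not overlap; for `t = u`
it contains the freedom from collisions between the agents. -/
structure IsReferencePlan (A : AgentSystem n) (T : ℝ) (p v : Fin n → ℝ → Plane) : Prop where
  time_pos : 0 < T
  at_start : ∀ i, p i 0 = A.start i
  at_dest : ∀ i, p i T = A.dest i
  continuousOn : ∀ i, ContinuousOn (p i) (Set.Icc 0 T)
  velocity : ∀ i, ∀ t ∈ Set.Ico 0 T, HasDerivWithinAt (p i) (v i t) (Set.Ici t) t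
  velocity_bounded : BddAbove {x : ℝ | ∃ i, ∃ t ∈ Set.Ico 0 T, x = ‖v i t‖}
  mem_env : ∀ i, ∀ t ∈ Set.Icc 0 T, Metric.closedBall (p i t) (A.radius i) ⊆ A.env
  non_overlap : ∀ i j, i ≠ j → ∀ t ∈ Set.Icc 0 T, ∀ u ∈ Set.Icc 0 T,
    A.radius i + A.radius j ≤ dist (p i t) (p j u)

/-- An obstacle region for the given task: a closed part of the environment that does not meet
the starting and destination regions. -/
structure IsInitialObstacle (A : AgentSystem n) (Δ₀ : Set Plane) : Prop where
  closed : IsClosed Δ₀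
  subset : Δ₀ ⊆ A.env \ (A.startRegion ∪ A.destRegion)

end AgentSystem

/-- The maximal speed along the trajectories of `n` agents, on the time interval `[0, T)`. -/
def maxSpeed {n : ℕ} (T : ℝ) (v : Fin n → ℝ → Plane) : ℝ :=
  sSup {x : ℝ | ∃ i, ∃ t ∈ Set.Ico 0 T, x = ‖v i t‖}

/-- An online change of the obstacle region, at times `t ≥ 0`, with capacity `c`: it starts with
the given region, stays a closed part of the environment, keeps the area, and the area changed
between the times `s ≤ t`, which is half the area of the symmetric difference, is at
most `c (t - s)`. -/
structure IsObstacleEvolution (E Δ₀ : Set Plane) (c : ℝ) (Δ : ℝ → Set Plane) : Prop where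
  initial : Δ 0 = Δ₀
  closed : ∀ t, 0 ≤ t → IsClosed (Δ t)
  subset : ∀ t, 0 ≤ t → Δ t ⊆ E
  area : ∀ t, 0 ≤ t → volume (Δ t) = volume Δ₀
  rate : ∀ s t, 0 ≤ s → s ≤ t →
    volume (symmDiff (Δ s) (Δ t)) / 2 ≤ ENNReal.ofReal (c * (t - s))

/-- The motion `q` on `[0, ∞)` follows the trajectory `p : [0, T] → ℝ²` from its beginning,
possibly with waiting and slowing down, but never backwards and never faster than `p`. -/
def FollowsTrajectory (T : ℝ) (p q : ℝ → Plane) : Prop :=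
  ∃ σ : ℝ → ℝ, σ 0 = 0 ∧ MonotoneOn σ (Set.Ici 0) ∧ LipschitzOnWith 1 σ (Set.Ici 0) ∧
    ∀ t, 0 ≤ t → σ t ∈ Set.Icc 0 T ∧ q t = p (σ t)

/-- The motions `q i` of agents with radii `r i` never collide with each other, nor with
the moving obstacle region. -/
structure CollisionFree {n : ℕ} (r : Fin n → ℝ) (Δ : ℝ → Set Plane)
    (q : Fin n → ℝ → Plane) : Prop where
  agents : ∀ i j, i ≠ j → ∀ t, 0 ≤ t → r i + r j ≤ dist (q i t) (q j t)
  obstacles : ∀ i t, 0 ≤ t → ∀ z ∈ Δ t, r i ≤ dist (q i t) z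

/-- The motion `q` arrives at `d` at some time `τ ≤ Tmax`, and stays there. -/
def ReachesWithin (Tmax : ℝ) (d : Plane) (q : ℝ → Plane) : Prop :=
  ∃ τ, 0 ≤ τ ∧ τ ≤ Tmax ∧ ∀ t, τ ≤ t → q t = d

end

open Metric

/-! All of the first `np` agents can move at once, slowed down by the common factor `l = min(np, b)
/ (2 np)`, while the others wait at their starts. An obstacle is removed only while a disk covers
it, and the same area is stored in the part of that agent's start disk that the agent has vacated.
Since the tracks keep clear of each other at all pairs of times, no other agent ever meets this
store.

A displacement `δ` of a disk of radius `r` costs changed area at most `π r δ`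
(`volumeReal_refill_change_le`), so `exists_obstacleEvolution` needs capacity `π ∑ rᵢ Lᵢ` for speeds
`Lᵢ`. The speed factors add up to at most `b / 2`, and `π ≤ 4` brings the cost below `2 b r̂ v̂`.

The travel time is `T / l = 2 T np / min(np, b)`. Replacing each `min(j, b)` by `min(np, b)` makes
the deadline sum telescope, which gives exactly that this time is at most `Tmax`
(`DeadlineCondition.le_mul_min`). -/

/-! ### Areas of displaced disks -/

theorem volumeReal_ball_plane (x : Plane) {r : ℝ} (hr : 0 ≤ r) :
    volume.real (ball x r) = Real.pi * r ^ 2 := by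
  rw [measureReal_def, EuclideanSpace.volume_ball_fin_two, ← ENNReal.ofReal_pow hr]
  simp [ENNReal.toReal_mul, hr, mul_comm, Real.pi_pos.le]

theorem volumeReal_closedBall_plane (x : Plane) {r : ℝ} (hr : 0 ≤ r) :
    volume.real (closedBall x r) = Real.pi * r ^ 2 := by
  rw [measureReal_def, Measure.addHaar_closedBall_eq_addHaar_ball, ← measureReal_def,
    volumeReal_ball_plane x hr]

/-- Removing a disk from an equally large one leaves equal areas on both sides. -/
theorem volumeReal_ball_diff_comm (x y : Plane) {r : ℝ} (hr : 0 ≤ r) :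
    volume.real (ball y r \ ball x r) = volume.real (ball x r \ ball y r) := by
  have h1 := measureReal_inter_add_sdiff (μ := volume) (s := ball x r)
    (measurableSet_ball (x := y) (ε := r))
    measure_ball_lt_top.ne
  have h2 := measureReal_inter_add_sdiff (μ := volume) (s := ball y r)
    (measurableSet_ball (x := x) (ε := r))
    measure_ball_lt_top.ne
  rw [volumeReal_ball_plane _ hr] at h1 h2
  rw [Set.inter_comm] at h2
  linarith

/-- A disk of radius `r` that is displaced by `δ` covers new area at most `π r δ`. -/
theorem volumeReal_ball_diff_le (x y : Plane) {r : ℝ} (hr : 0 < r) :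
    volume.real (ball y r \ ball x r) ≤ Real.pi * r * dist x y := by
  have hd : 0 ≤ dist x y := dist_nonneg
  have hpi := Real.pi_pos
  rcases le_or_gt (2 * r) (dist x y) with h | h
  · calc volume.real (ball y r \ ball x r) ≤ volume.real (ball y r) :=
          measureReal_mono Set.sdiff_subset measure_ball_lt_top.ne
      _ = Real.pi * r * r := by rw [volumeReal_ball_plane _ hr.le]; ring
      _ ≤ Real.pi * r * dist x y := by gcongr; linarith
  · set m : Plane := midpoint ℝ x y
    have hmx : dist x m = dist x y / 2 := by
      rw [dist_left_midpoint]; norm_num; ring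
    have hmy : dist y m = dist x y / 2 := by
      rw [dist_right_midpoint]; norm_num; ring
    -- The two lunes lie in an annulus about the midpoint of area `2 π r · dist x y`, and they have
    -- equal areas.
    have hsub : (ball y r \ ball x r) ∪ (ball x r \ ball y r) ∪ ball m (r - dist x y / 2) ⊆
        ball m (r + dist x y / 2) := by
      refine Set.union_subset (Set.union_subset ?_ ?_) ?_
      · exact Set.sdiff_subset.trans (ball_subset_ball' (by linarith))
      · exact Set.sdiff_subset.trans (ball_subset_ball' (by linarith))
      · exact ball_subset_ball (by linarith)
    have hmx' : ball m (r - dist x y / 2) ⊆ ball x r :=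
      ball_subset_ball' (by rw [dist_comm m x]; linarith)
    have hmy' : ball m (r - dist x y / 2) ⊆ ball y r :=
      ball_subset_ball' (by rw [dist_comm m y]; linarith)
    have hle := measureReal_mono (μ := volume) hsub measure_ball_lt_top.ne
    rw [measureReal_union _ measurableSet_ball
        (measure_union_lt_top (measure_lt_top_of_subset Set.sdiff_subset measure_ball_lt_top.ne)
          (measure_lt_top_of_subset Set.sdiff_subset measure_ball_lt_top.ne)).ne
        measure_ball_lt_top.ne,
      measureReal_union _ (measurableSet_ball.diff measurableSet_ball)
        (measure_lt_top_of_subset Set.sdiff_subset measure_ball_lt_top.ne).ne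
        (measure_lt_top_of_subset Set.sdiff_subset measure_ball_lt_top.ne).ne,
      volumeReal_ball_diff_comm x y hr.le, volumeReal_ball_plane _ (by linarith),
      volumeReal_ball_plane _ (by linarith)] at hle
    · rw [volumeReal_ball_diff_comm x y hr.le]
      nlinarith
    · exact Set.disjoint_left.2 fun z hz hz' => hz'.2 hz.1
    · refine Set.disjoint_left.2 fun z hz hz' => ?_
      rcases hz with hz | hz
      · exact hz.2 (hmx' hz')
      · exact hz.2 (hmy' hz')

/-! ### Storing the displaced area in the start disk -/

/-- A measurable part of a disk contains pieces of any smaller area that are cut out by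
concentric disks. The radius `-1`, that is, the empty piece, is taken for the area zero. -/
theorem exists_radius_volumeReal_inter_eq (s : Plane) {r : ℝ} (hr : 0 ≤ r) {C : Set Plane}
    (hCm : MeasurableSet C) (hC : C ⊆ closedBall s r) {m : ℝ} (hm0 : 0 ≤ m)
    (hm : m ≤ volume.real C) :
    ∃ ρ : ℝ, volume.real (C ∩ closedBall s ρ) = m ∧ (m = 0 → ρ = -1) := by
  rcases eq_or_lt_of_le hm0 with h0 | h0
  -- For area zero many radii could serve. A negative one makes the piece literally empty, so that
  -- the evolution starts with `Δ₀` itself and not just up to a null set.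
  · exact ⟨-1, by rw [closedBall_eq_empty.2 (by norm_num)]; simp [h0], fun _ => rfl⟩
  set g : ℝ → ℝ := fun ρ => volume.real (C ∩ closedBall s ρ) with hg
  have hfin : ∀ ρ, volume (C ∩ closedBall s ρ) ≠ ⊤ := fun ρ =>
    (measure_lt_top_of_subset Set.inter_subset_right measure_closedBall_lt_top.ne).ne
  -- The part of the disk outside `C` grows with the radius too, so `C` gains at most the area of
  -- the annulus.
  have hincr : ∀ a b, 0 ≤ a → a ≤ b →
      g a ≤ g b ∧ g b - g a ≤ Real.pi * b ^ 2 - Real.pi * a ^ 2 := by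
    intro a b ha hab
    refine ⟨measureReal_mono (Set.inter_subset_inter_right _ (closedBall_subset_closedBall hab))
      (hfin b), ?_⟩
    have h1 := measureReal_inter_add_sdiff (μ := volume) (s := closedBall s a) hCm
      measure_closedBall_lt_top.ne
    have h2 := measureReal_inter_add_sdiff (μ := volume) (s := closedBall s b) hCm
      measure_closedBall_lt_top.ne
    have h3 : volume.real (closedBall s a \ C) ≤ volume.real (closedBall s b \ C) :=
      measureReal_mono (Set.sdiff_subset_sdiff_left (closedBall_subset_closedBall hab))
        (measure_lt_top_of_subset Set.sdiff_subset measure_closedBall_lt_top.ne).ne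
    rw [volumeReal_closedBall_plane _ ha, Set.inter_comm] at h1
    rw [volumeReal_closedBall_plane _ (ha.trans hab), Set.inter_comm] at h2
    simp only [hg]
    linarith
  have hlip : LipschitzOnWith (Real.toNNReal (2 * Real.pi * r)) g (Set.Icc 0 r) := by
    refine LipschitzOnWith.of_le_add_mul' _ fun a ha b hb => ?_
    have hpi := Real.pi_pos
    rcases le_total a b with hab | hab
    · have := (hincr a b ha.1 hab).1
      have : 0 ≤ 2 * Real.pi * r * dist a b := by positivity
      linarith
    · have h := (hincr b a hb.1 hab).2
      rw [Real.dist_eq, abs_of_nonneg (sub_nonneg.2 hab)]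
      have : Real.pi * a ^ 2 - Real.pi * b ^ 2 ≤ 2 * Real.pi * r * (a - b) := by
        have : Real.pi * a ^ 2 - Real.pi * b ^ 2 = Real.pi * (a + b) * (a - b) := by ring
        rw [this]
        have h5 : Real.pi * (a + b) ≤ 2 * Real.pi * r := by nlinarith [ha.2, hb.2]
        exact mul_le_mul_of_nonneg_right h5 (sub_nonneg.2 hab)
      linarith
  have hg0 : g 0 = 0 := by
    have h : volume.real (closedBall s 0) = 0 := by
      rw [volumeReal_closedBall_plane s le_rfl]; simp
    exact le_antisymm
      ((measureReal_mono Set.inter_subset_right measure_closedBall_lt_top.ne).trans_eq h)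
      measureReal_nonneg
  have hgr : g r = volume.real C := by
    simp only [hg, Set.inter_eq_left.2 hC]
  obtain ⟨ρ, -, hρ⟩ := intermediate_value_Icc hr hlip.continuousOn
    (show m ∈ Set.Icc (g 0) (g r) by rw [hg0, hgr]; exact ⟨hm0, hm⟩)
  exact ⟨ρ, hρ, fun h => absurd h h0.ne'⟩

/-- An obstacle region that does not meet the disk at `s` covers in a disk at `x` at most as much
area as is left over in the disk at `s`. -/
theorem volumeReal_inter_ball_le {D : Set Plane} {s : Plane} {r : ℝ} (hr : 0 ≤ r)
    (hDs : Disjoint D (closedBall s r)) (x : Plane) :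
    volume.real (D ∩ ball x r) ≤ volume.real (closedBall s r \ ball x r) := by
  calc volume.real (D ∩ ball x r) ≤ volume.real (ball x r \ ball s r) :=
        measureReal_mono (fun z hz => ⟨hz.2, fun h =>
          Set.disjoint_left.1 hDs hz.1 (ball_subset_closedBall h)⟩)
          (measure_lt_top_of_subset Set.sdiff_subset measure_ball_lt_top.ne).ne
    _ = volume.real (ball s r \ ball x r) := volumeReal_ball_diff_comm s x hr
    _ ≤ volume.real (closedBall s r \ ball x r) :=
        measureReal_mono (Set.sdiff_subset_sdiff_left ball_subset_closedBall)
          (measure_lt_top_of_subset Set.sdiff_subset measure_closedBall_lt_top.ne).ne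

theorem exists_refill_radius {D : Set Plane} {s : Plane} {r : ℝ} (hr : 0 ≤ r)
    (hDs : Disjoint D (closedBall s r)) (x : Plane) :
    ∃ ρ : ℝ, volume.real ((closedBall s r \ ball x r) ∩ closedBall s ρ) =
      volume.real (D ∩ ball x r) ∧ (volume.real (D ∩ ball x r) = 0 → ρ = -1) :=
  exists_radius_volumeReal_inter_eq s hr (measurableSet_closedBall.diff measurableSet_ball)
    Set.sdiff_subset measureReal_nonneg (volumeReal_inter_ball_le hr hDs x)

/-- The pieces are cut out by nested concentric disks. As `ρ ≤ ρ'`, a stored point can be given up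
only because the disk at `y` now covers it. Both this loss and the newly covered obstacles therefore
lie in `ball y r \ ball x r`, and they are disjoint because `D` misses the start disk. -/
theorem volumeReal_refill_change_le_of_le {D : Set Plane} (hD : MeasurableSet D) {s : Plane}
    {r : ℝ} (hDs : Disjoint D (closedBall s r)) {x y : Plane}
    {ρ ρ' : ℝ} (hle : ρ ≤ ρ')
    (hρ : volume.real ((closedBall s r \ ball x r) ∩ closedBall s ρ) =
      volume.real (D ∩ ball x r))
    (hρ' : volume.real ((closedBall s r \ ball y r) ∩ closedBall s ρ') =
      volume.real (D ∩ ball y r)) :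
    volume.real (D ∩ symmDiff (ball x r) (ball y r)) +
      volume.real (symmDiff ((closedBall s r \ ball x r) ∩ closedBall s ρ)
        ((closedBall s r \ ball y r) ∩ closedBall s ρ')) ≤
      2 * volume.real (ball y r \ ball x r) := by
  set R := (closedBall s r \ ball x r) ∩ closedBall s ρ with hR
  set R' := (closedBall s r \ ball y r) ∩ closedBall s ρ' with hR'
  have hRm : MeasurableSet R :=
    (measurableSet_closedBall.diff measurableSet_ball).inter measurableSet_closedBall
  have hRm' : MeasurableSet R' :=
    (measurableSet_closedBall.diff measurableSet_ball).inter measurableSet_closedBall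
  have hRf : volume R ≠ ⊤ :=
    (measure_lt_top_of_subset Set.inter_subset_right measure_closedBall_lt_top.ne).ne
  have hRf' : volume R' ≠ ⊤ :=
    (measure_lt_top_of_subset Set.inter_subset_right measure_closedBall_lt_top.ne).ne
  have hf : ∀ z, volume (D ∩ ball z r) ≠ ⊤ := fun z =>
    (measure_lt_top_of_subset Set.inter_subset_right measure_ball_lt_top.ne).ne
  have hxy : volume (ball y r \ ball x r) ≠ ⊤ :=
    (measure_lt_top_of_subset Set.sdiff_subset measure_ball_lt_top.ne).ne
  have e1 := measureReal_inter_add_sdiff (μ := volume) (s := R) hRm' hRf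
  have e2 := measureReal_inter_add_sdiff (μ := volume) (s := R') hRm hRf'
  have e3 := measureReal_inter_add_sdiff (μ := volume) (s := D ∩ ball x r)
    (hD.inter (measurableSet_ball (x := y) (ε := r))) (hf x)
  have e4 := measureReal_inter_add_sdiff (μ := volume) (s := D ∩ ball y r)
    (hD.inter (measurableSet_ball (x := x) (ε := r))) (hf y)
  rw [Set.inter_comm] at e2 e4
  have b1 : volume.real (symmDiff R R') ≤ volume.real (R \ R') + volume.real (R' \ R) :=
    measureReal_union_le _ _
  have b2 : volume.real (D ∩ symmDiff (ball x r) (ball y r)) ≤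
      volume.real ((D ∩ ball x r) \ (D ∩ ball y r)) +
      volume.real ((D ∩ ball y r) \ (D ∩ ball x r)) := by
    refine le_trans (measureReal_mono ?_ ?_) (measureReal_union_le _ _)
    · rintro z ⟨hz, h | h⟩
      · exact Or.inl ⟨⟨hz, h.1⟩, fun h' => h.2 h'.2⟩
      · exact Or.inr ⟨⟨hz, h.1⟩, fun h' => h.2 h'.2⟩
    · exact (measure_union_lt_top (measure_lt_top_of_subset Set.sdiff_subset (hf x))
        (measure_lt_top_of_subset Set.sdiff_subset (hf y))).ne
  have b3 : volume.real ((D ∩ ball y r) \ (D ∩ ball x r)) + volume.real (R \ R') ≤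
      volume.real (ball y r \ ball x r) := by
    rw [← measureReal_union _ (hRm.diff hRm')
      (measure_lt_top_of_subset Set.sdiff_subset (hf y)).ne
      (measure_lt_top_of_subset Set.sdiff_subset hRf).ne]
    · refine measureReal_mono (Set.union_subset ?_ ?_) hxy
      · exact fun z hz => ⟨hz.1.2, fun h => hz.2 ⟨hz.1.1, h⟩⟩
      · refine fun z hz => ⟨?_, hz.1.1.2⟩
        by_contra h
        exact hz.2 ⟨⟨hz.1.1.1, h⟩, closedBall_subset_closedBall hle hz.1.2⟩
    · exact Set.disjoint_left.2 fun z hz hz' => Set.disjoint_left.1 hDs hz.1.1 hz'.1.1.1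
  -- By the equalities of areas, obstacles uncovered plus storage gained equal obstacles newly
  -- covered plus storage lost, which `b3` bounds; hence the factor 2.
  linarith

/-- The area changed when a disk moves from `x` to `y`, the obstacles in its way being moved into
the disk at `s`. -/
theorem volumeReal_refill_change_le {D : Set Plane} (hD : MeasurableSet D) {s : Plane}
    {r : ℝ} (hr : 0 < r) (hDs : Disjoint D (closedBall s r)) {x y : Plane} {ρ ρ' : ℝ}
    (hρ : volume.real ((closedBall s r \ ball x r) ∩ closedBall s ρ) =
      volume.real (D ∩ ball x r))
    (hρ' : volume.real ((closedBall s r \ ball y r) ∩ closedBall s ρ') =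
      volume.real (D ∩ ball y r)) :
    volume.real (D ∩ symmDiff (ball x r) (ball y r)) +
      volume.real (symmDiff ((closedBall s r \ ball x r) ∩ closedBall s ρ)
        ((closedBall s r \ ball y r) ∩ closedBall s ρ')) ≤
      2 * (Real.pi * r * dist x y) := by
  rcases le_total ρ ρ' with h | h
  · have := volumeReal_refill_change_le_of_le hD hDs h hρ hρ'
    linarith [volumeReal_ball_diff_le x y hr]
  · have := volumeReal_refill_change_le_of_le hD hDs h hρ' hρ
    rw [symmDiff_comm (ball x r), symmDiff_comm ((closedBall s r \ ball x r) ∩ closedBall s ρ),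
      dist_comm]
    linarith [volumeReal_ball_diff_le y x hr]

/-! ### Consequences of the deadline condition and the speed bound -/

namespace AgentSystem

variable {n : ℕ} {A : AgentSystem n}

theorem WellPosed.invPriority_le_succ (hA : A.WellPosed) {k : ℕ} (hk : k + 1 ≤ n) :
    A.invPriority k ≤ A.invPriority (k + 1) := by
  have hpos := hA.priority_pos
  unfold invPriority
  rw [dif_pos (show 1 ≤ k + 1 ∧ k + 1 ≤ n from ⟨by omega, hk⟩)]
  split_ifs with h
  · exact one_div_le_one_div_of_le (hpos _) (hA.priority_antitone (Fin.mk_le_mk.2 (by omega)))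
  · exact (one_div_pos.2 (hpos _)).le

/-- The deadline condition leaves at least twice the time that the first `η` agents need
if `b` of them are moving at a time. -/
theorem DeadlineCondition.le_mul_min (hA : A.WellPosed) {b η : ℕ} {T Tmax : ℝ}
    (h1 : 1 ≤ η) (hn : η ≤ n) (h : A.DeadlineCondition b T Tmax η) :
    (η : ℝ) ≤ Tmax / (2 * T) * (min η b : ℕ) := by
  have hρ : 0 < A.priorityAt η := by
    rw [priorityAt, dif_pos ⟨h1, hn⟩]; exact hA.priority_pos _
  set X : ℝ := ∑ j ∈ Finset.Icc 1 η, ((min j b : ℕ) : ℝ) *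
    (A.invPriority (η + 1 - j) - A.invPriority (η - j)) with hX
  have hterm : ∀ j ∈ Finset.Icc 1 η,
      0 ≤ A.invPriority (η + 1 - j) - A.invPriority (η - j) := by
    intro j hj
    rw [Finset.mem_Icc] at hj
    rw [show η + 1 - j = η - j + 1 by omega]
    exact sub_nonneg.2 (hA.invPriority_le_succ (by omega))
  have hX0 : 0 ≤ X := Finset.sum_nonneg fun j hj => mul_nonneg (Nat.cast_nonneg _) (hterm j hj)
  have htel : ∑ j ∈ Finset.Icc 1 η, (A.invPriority (η + 1 - j) - A.invPriority (η - j)) =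
      A.invPriority η - A.invPriority 0 := by
    have := Finset.sum_range_sub (fun i => - A.invPriority (η - i)) η
    rw [← Finset.sum_bij (s := Finset.range η) (fun i _ => i + 1)
      (f := fun i => - A.invPriority (η - (i + 1)) - - A.invPriority (η - i))]
    · rw [this]; simp; ring
    · intro i hi; simp at hi ⊢; omega
    · intro i _ j _ hij; omega
    · intro j hj
      rw [Finset.mem_Icc] at hj
      exact ⟨j - 1, by simp; omega, by omega⟩
    · intro i hi
      rw [show η + 1 - (i + 1) = η - i by omega]; ring
  have h0 : A.invPriority 0 = 0 := by simp [invPriority]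
  have hinv : A.priorityAt η * A.invPriority η = 1 := by
    rw [priorityAt, dif_pos ⟨h1, hn⟩, invPriority, dif_pos ⟨h1, hn⟩]
    exact mul_one_div_cancel (hA.priority_pos _).ne'
  have hXle : X ≤ (min η b : ℕ) * A.invPriority η := by
    calc X ≤ ∑ j ∈ Finset.Icc 1 η, ((min η b : ℕ) : ℝ) *
          (A.invPriority (η + 1 - j) - A.invPriority (η - j)) := by
          refine Finset.sum_le_sum fun j hj => mul_le_mul_of_nonneg_right ?_ (hterm j hj)
          rw [Finset.mem_Icc] at hj
          exact_mod_cast min_le_min_right b hj.2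
      _ = (min η b : ℕ) * A.invPriority η := by rw [← Finset.mul_sum, htel, h0, sub_zero]
  have hYle : A.priorityAt η * X ≤ (min η b : ℕ) := by
    calc A.priorityAt η * X ≤ A.priorityAt η * ((min η b : ℕ) * A.invPriority η) :=
          mul_le_mul_of_nonneg_left hXle hρ.le
      _ = (min η b : ℕ) * (A.priorityAt η * A.invPriority η) := by ring
      _ = (min η b : ℕ) := by rw [hinv, mul_one]
  have hsum : (η : ℝ) ≤ Tmax / (2 * T) * (A.priorityAt η * X) := by
    refine le_of_le_of_eq h ?_
    rw [hX, Finset.mul_sum, Finset.mul_sum]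
    refine Finset.sum_congr rfl fun j _ => ?_
    ring
  have hη : (0 : ℝ) < η := by exact_mod_cast h1
  -- A negative `Tmax` would make the right side of `hsum` nonpositive, while `η ≥ 1`.
  have hc : 0 ≤ Tmax / (2 * T) := by
    by_contra hneg
    have := mul_nonpos_of_nonpos_of_nonneg (not_le.1 hneg).le (mul_nonneg hρ.le hX0)
    linarith
  exact hsum.trans (mul_le_mul_of_nonneg_left hYle hc)

theorem IsReferencePlan.dist_le {T : ℝ} {p v : Fin n → ℝ → Plane} (hp : A.IsReferencePlan T p v)
    (i : Fin n) {a b : ℝ} (ha : 0 ≤ a) (hab : a ≤ b) (hb : b ≤ T) :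
    dist (p i a) (p i b) ≤ maxSpeed T v * (b - a) := by
  rw [dist_comm, dist_eq_norm]
  refine norm_image_sub_le_of_norm_deriv_right_le_segment (f' := v i)
    ((hp.continuousOn i).mono (Set.Icc_subset_Icc ha hb)) (fun t ht => ?_) (fun t ht => ?_) b
    (Set.right_mem_Icc.2 hab)
  · exact hp.velocity i t ⟨ha.trans ht.1, ht.2.trans_le hb⟩
  · exact le_csSup hp.velocity_bounded ⟨i, t, ⟨ha.trans ht.1, ht.2.trans_le hb⟩, rfl⟩

end AgentSystem

/-! ### The evolution of the obstacle region -/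

theorem symmDiff_sdiff_union_iUnion_subset {ι α : Type*} (D : Set α) (B B' R R' : ι → Set α) :
    symmDiff ((D \ ⋃ i, B i) ∪ ⋃ i, R i) ((D \ ⋃ i, B' i) ∪ ⋃ i, R' i) ⊆
      ⋃ i, ((D ∩ symmDiff (B i) (B' i)) ∪ symmDiff (R i) (R' i)) := by
  intro z hz
  simp only [Set.mem_symmDiff, Set.mem_union, Set.mem_sdiff, Set.mem_iUnion,
    Set.mem_inter_iff] at hz ⊢
  grind

/-- Disks that move with bounded speeds, each along a track that keeps clear of those of the other
disks, can push the obstacles out of their way: what a disk covers is moved to its initial place. -/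
theorem exists_obstacleEvolution {n : ℕ} {E Δ₀ : Set Plane} (hclosed : IsClosed Δ₀)
    (hsub : Δ₀ ⊆ E) {r L : Fin n → ℝ} {q : Fin n → ℝ → Plane} (hr : ∀ i, 0 < r i)
    (hE : ∀ i, closedBall (q i 0) (r i) ⊆ E) (hdisj : ∀ i, Disjoint Δ₀ (closedBall (q i 0) (r i)))
    (hsep : ∀ i j, i ≠ j → ∀ t, 0 ≤ t → ∀ u, 0 ≤ u → r i + r j ≤ dist (q i t) (q j u))
    (hL : ∀ i s t, 0 ≤ s → s ≤ t → dist (q i s) (q i t) ≤ L i * (t - s)) {c : ℝ}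
    (hc : Real.pi * ∑ i, r i * L i ≤ c) :
    ∃ Δ : ℝ → Set Plane, IsObstacleEvolution E Δ₀ c Δ ∧
      ∀ i t, 0 ≤ t → ∀ z ∈ Δ t, r i ≤ dist (q i t) z := by
  have hD : MeasurableSet Δ₀ := hclosed.measurableSet
  choose ρ hρ hρ0 using fun i t => exists_refill_radius (hr i).le (hdisj i) (q i t)
  set B : Fin n → ℝ → Set Plane := fun i t => ball (q i t) (r i) with hB
  set R : Fin n → ℝ → Set Plane := fun i t =>
    (closedBall (q i 0) (r i) \ ball (q i t) (r i)) ∩ closedBall (q i 0) (ρ i t) with hR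
  have hBm : ∀ i t, MeasurableSet (B i t) := fun i t => measurableSet_ball
  have hRm : ∀ i t, MeasurableSet (R i t) := fun i t =>
    (measurableSet_closedBall.diff measurableSet_ball).inter measurableSet_closedBall
  have hRS : ∀ i t, R i t ⊆ closedBall (q i 0) (r i) := fun i t z hz => hz.1.1
  have hRf : ∀ i t, volume (R i t) ≠ ⊤ := fun i t =>
    (measure_lt_top_of_subset (hRS i t) measure_closedBall_lt_top.ne).ne
  have hBf : ∀ i t, volume (Δ₀ ∩ B i t) ≠ ⊤ := fun i t =>
    (measure_lt_top_of_subset Set.inter_subset_right measure_ball_lt_top.ne).ne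
  have hvol : ∀ i t, volume (R i t) = volume (Δ₀ ∩ B i t) := fun i t =>
    (ENNReal.toReal_eq_toReal_iff' (hRf i t) (hBf i t)).1 (hρ i t)
  refine ⟨fun t => (Δ₀ \ ⋃ i, B i t) ∪ ⋃ i, R i t, ⟨?_, ?_, ?_, ?_, ?_⟩, ?_⟩
  · have h0 : ∀ i, Δ₀ ∩ B i 0 = ∅ := fun i =>
      Set.disjoint_iff_inter_eq_empty.1 ((hdisj i).mono_right ball_subset_closedBall)
    have hR0 : ∀ i, R i 0 = ∅ := by
      intro i
      have h := hρ0 i 0 (by rw [show Δ₀ ∩ ball (q i 0) (r i) = ∅ from h0 i]; simp)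
      simp only [hR]
      rw [h, closedBall_eq_empty.2 (show (-1 : ℝ) < 0 by norm_num), Set.inter_empty]
    simp only [hR0, Set.iUnion_empty, Set.union_empty]
    rw [sdiff_eq_left, Set.disjoint_iUnion_right]
    exact fun i => Set.disjoint_iff_inter_eq_empty.2 (h0 i)
  · intro t _
    refine (hclosed.sdiff (isOpen_iUnion fun i => isOpen_ball)).union
      (isClosed_iUnion_of_finite fun i => ?_)
    exact (isClosed_closedBall.sdiff isOpen_ball).inter isClosed_closedBall
  · intro t _
    exact Set.union_subset (Set.sdiff_subset.trans hsub)
      (Set.iUnion_subset fun i => (hRS i t).trans (hE i))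
  · intro t ht
    -- Closed start disks may touch, but their common points lie on a circle, a null set.
    have hRd : Pairwise (Function.onFun (AEDisjoint volume) fun i => R i t) := by
      intro i j hij
      refine measure_mono_null (fun z hz => ?_) (Measure.addHaar_sphere volume (q i 0) (r i))
      have h1 := mem_closedBall.1 (hRS i t hz.1)
      have h2 := mem_closedBall.1 (hRS j t hz.2)
      have h3 := hsep i j hij 0 le_rfl 0 le_rfl
      have h4 := dist_triangle_left (q i 0) (q j 0) z
      exact mem_sphere.2 (by linarith)
    have hBd : Pairwise (Function.onFun Disjoint fun i => Δ₀ ∩ B i t) := by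
      intro i j hij
      exact (ball_disjoint_ball (hsep i j hij t ht t ht)).mono Set.inter_subset_right
        Set.inter_subset_right
    have hdis : Disjoint (Δ₀ \ ⋃ i, B i t) (⋃ i, R i t) :=
      Set.disjoint_iUnion_right.2 fun i => (hdisj i).mono Set.sdiff_subset (hRS i t)
    rw [measure_union hdis (MeasurableSet.iUnion fun i => hRm i t),
      measure_iUnion₀ hRd fun i => (hRm i t).nullMeasurableSet]
    simp only [hvol]
    rw [← measure_iUnion hBd fun i => hD.inter (hBm i t), ← Set.inter_iUnion, add_comm,
      measure_inter_add_sdiff _ (MeasurableSet.iUnion fun i => hBm i t)]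
  · intro s t hs hst
    have hsub : symmDiff ((Δ₀ \ ⋃ i, B i s) ∪ ⋃ i, R i s) ((Δ₀ \ ⋃ i, B i t) ∪ ⋃ i, R i t) ⊆
        ⋃ i, ((Δ₀ ∩ symmDiff (B i s) (B i t)) ∪ symmDiff (R i s) (R i t)) :=
      symmDiff_sdiff_union_iUnion_subset _ _ _ _ _
    have hstep : ∀ i, volume ((Δ₀ ∩ symmDiff (B i s) (B i t)) ∪ symmDiff (R i s) (R i t)) ≤
        ENNReal.ofReal (2 * (Real.pi * r i * (L i * (t - s)))) := by
      intro i
      have hf1 : volume (Δ₀ ∩ symmDiff (B i s) (B i t)) ≠ ⊤ := by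
        have hsub : Δ₀ ∩ symmDiff (B i s) (B i t) ⊆ B i s ∪ B i t := fun z hz =>
          symmDiff_le_sup (a := B i s) hz.2
        exact (measure_lt_top_of_subset hsub
          (measure_union_lt_top measure_ball_lt_top measure_ball_lt_top).ne).ne
      have hf2 : volume (symmDiff (R i s) (R i t)) ≠ ⊤ :=
        (measure_lt_top_of_subset (symmDiff_le_sup (a := R i s))
          (measure_union_lt_top (hRf i s).lt_top (hRf i t).lt_top).ne).ne
      refine (measure_union_le _ _).trans ?_
      rw [← ENNReal.ofReal_toReal hf1, ← ENNReal.ofReal_toReal hf2,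
        ← ENNReal.ofReal_add ENNReal.toReal_nonneg ENNReal.toReal_nonneg]
      refine ENNReal.ofReal_le_ofReal
        ((volumeReal_refill_change_le hD (hr i) (hdisj i) (hρ i s) (hρ i t)).trans ?_)
      have := mul_pos Real.pi_pos (hr i)
      have := mul_le_mul_of_nonneg_left (hL i s t hs hst) this.le
      linarith
    have hts : 0 ≤ t - s := sub_nonneg.2 hst
    have hnn : ∀ i, 0 ≤ 2 * (Real.pi * r i * (L i * (t - s))) := fun i =>
      mul_nonneg zero_le_two (mul_nonneg (mul_pos Real.pi_pos (hr i)).le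
        (dist_nonneg.trans (hL i s t hs hst)))
    refine ENNReal.div_le_of_le_mul ?_
    calc _ ≤ ∑ i, ENNReal.ofReal (2 * (Real.pi * r i * (L i * (t - s)))) :=
          (measure_mono hsub).trans
            ((measure_iUnion_fintype_le _ _).trans (Finset.sum_le_sum fun i _ => hstep i))
      _ = ENNReal.ofReal (Real.pi * (∑ i, r i * L i) * (t - s) * 2) := by
          rw [← ENNReal.ofReal_sum_of_nonneg fun i _ => hnn i, Finset.mul_sum, Finset.sum_mul,
            Finset.sum_mul]
          congr 1
          exact Finset.sum_congr rfl fun i _ => by ring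
      _ ≤ ENNReal.ofReal (c * (t - s) * 2) := by gcongr
      _ = ENNReal.ofReal (c * (t - s)) * 2 := by
          rw [ENNReal.ofReal_mul' zero_le_two, ENNReal.ofReal_ofNat]
  · rintro i t ht z (hz | hz)
    · by_contra h
      exact hz.2 (Set.mem_iUnion.2 ⟨i, mem_ball'.2 (not_le.1 h)⟩)
    · obtain ⟨j, hj⟩ := Set.mem_iUnion.1 hz
      rcases eq_or_ne i j with rfl | hij
      · by_contra h
        exact hj.1.2 (mem_ball'.2 (not_le.1 h))
      -- What agent `j` stores lies in its start disk, so the separation is needed between time `t`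
      -- and time `0`.
      · have h1 := hsep i j hij t ht 0 le_rfl
        have h2 := mem_closedBall.1 (hRS j t hj)
        have h3 := dist_triangle (q i t) z (q j 0)
        linarith

/-! ### The simultaneous slowed-down motion -/

theorem corollary2 {n : ℕ} (A : AgentSystem n) (hA : A.WellPosed)
    (T : ℝ) (p v : Fin n → ℝ → Plane) (hp : A.IsReferencePlan T p v)
    (Δ₀ : Set Plane) (hΔ₀ : A.IsInitialObstacle Δ₀)
    (hfree : (A.env \ (Δ₀ ∪ A.startRegion ∪ A.destRegion)).Nonempty)
    (b : ℕ) (hb1 : 1 ≤ b) (hbn : b < n) (c : ℝ)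
    (hc1 : 2 * b * A.maxRadius * maxSpeed T v ≤ c)
    (hc2 : c < 2 * (b + 1) * A.maxRadius * maxSpeed T v)
    (Tmax : ℝ) (np : ℕ)
    (hnp : IsGreatest {η : ℕ | 1 ≤ η ∧ η ≤ n ∧ A.DeadlineCondition b T Tmax η} np) :
    ∃ (Δ : ℝ → Set Plane) (q : Fin n → ℝ → Plane),
      IsObstacleEvolution A.env Δ₀ c Δ ∧
      (∀ i, FollowsTrajectory T (p i) (q i)) ∧
      CollisionFree A.radius Δ q ∧
      ∀ i : Fin n, (i : ℕ) < np → ReachesWithin Tmax (A.dest i) (q i) := by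
  obtain ⟨⟨hnp1, hnpn, hdead⟩, -⟩ := hnp
  have hT := hp.time_pos
  have hmin := hdead.le_mul_min hA hnp1 hnpn
  have hη : (0 : ℝ) < np := by exact_mod_cast hnp1
  set μ : ℝ := ((min np b : ℕ) : ℝ) with hμ
  have hμ0 : 0 < μ := by rw [hμ]; exact_mod_cast lt_min hnp1 hb1
  have hμη : μ ≤ np := by rw [hμ]; exact_mod_cast min_le_left np b
  have hμb : μ ≤ b := by rw [hμ]; exact_mod_cast min_le_right np b
  -- The common speed factor of the moving agents.
  set l : ℝ := μ / (2 * np) with hl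
  have hl0 : 0 < l := by positivity
  have hl1 : l ≤ 1 := by rw [hl, div_le_one (by positivity)]; linarith
  have hlT : T / l ≤ Tmax := by
    rw [hl, div_div_eq_mul_div, div_le_iff₀ hμ0]
    rw [div_mul_eq_mul_div, le_div_iff₀ (by positivity)] at hmin
    linarith
  set k : Fin n → ℝ := fun i => if (i : ℕ) < np then l else 0 with hk
  have hk0 : ∀ i, 0 ≤ k i := fun i => by simp only [hk]; split_ifs <;> linarith
  have hk1 : ∀ i, k i ≤ 1 := fun i => by simp only [hk]; split_ifs <;> linarith
  -- The cap at `T` keeps an agent at its destination after arrival.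
  set σ : Fin n → ℝ → ℝ := fun i t => min (k i * t) T with hσ
  have hσ0 : ∀ i, σ i 0 = 0 := fun i => by simp [hσ, hT.le]
  have hσmem : ∀ i t, 0 ≤ t → σ i t ∈ Set.Icc 0 T := fun i t ht =>
    ⟨le_min (mul_nonneg (hk0 i) ht) hT.le, min_le_right _ _⟩
  have hσmono : ∀ i, Monotone (σ i) := fun i s t hst =>
    min_le_min_right _ (mul_le_mul_of_nonneg_left hst (hk0 i))
  have hσsub : ∀ i s t, s ≤ t → σ i t - σ i s ≤ k i * (t - s) := by
    intro i s t hst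
    have h := mul_nonneg (hk0 i) (sub_nonneg.2 hst)
    simp only [hσ]
    rcases min_cases (k i * s) T with h1 | h1 <;> rw [h1.1]
    · linarith [min_le_left (k i * t) T]
    · linarith [min_le_right (k i * t) T]
  have hq0 : ∀ i, p i (σ i 0) = A.start i := fun i => by rw [hσ0, hp.at_start]
  have hV : 0 ≤ maxSpeed T v :=
    Real.sSup_nonneg fun x ⟨i, t, _, hx⟩ => hx ▸ norm_nonneg _
  have hrad : ∀ i, A.radius i ≤ A.maxRadius := fun i => le_ciSup (Set.finite_range _).bddAbove i
  have hrad0 : 0 ≤ A.maxRadius :=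
    (hA.radius_pos ⟨0, by omega⟩).le.trans (hrad ⟨0, by omega⟩)
  have hsum : ∑ i, A.radius i * (maxSpeed T v * k i) ≤ A.maxRadius * maxSpeed T v * (b / 2) := by
    calc ∑ i, A.radius i * (maxSpeed T v * k i)
        ≤ ∑ i, A.maxRadius * (maxSpeed T v * k i) := Finset.sum_le_sum fun i _ =>
          mul_le_mul_of_nonneg_right (hrad i) (mul_nonneg hV (hk0 i))
      _ = A.maxRadius * maxSpeed T v * ∑ i, k i := by
          rw [Finset.mul_sum]; exact Finset.sum_congr rfl fun i _ => by ring
      _ ≤ A.maxRadius * maxSpeed T v * (b / 2) := by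
          refine mul_le_mul_of_nonneg_left ?_ (mul_nonneg hrad0 hV)
          have hcard : (Finset.univ.filter fun i : Fin n => (i : ℕ) < np).card = np := by
            rw [Fin.card_filter_val_lt, min_eq_right hnpn]
          rw [← Finset.sum_filter, Finset.sum_const, hcard, nsmul_eq_mul, hl,
            show (np : ℝ) * (μ / (2 * np)) = μ / 2 by field_simp]
          linarith
  obtain ⟨Δ, hΔ, hobs⟩ := exists_obstacleEvolution (E := A.env) (r := A.radius)
    (L := fun i => maxSpeed T v * k i) (q := fun i t => p i (σ i t)) (c := c) hΔ₀.closed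
    (fun z hz => (hΔ₀.subset hz).1) hA.radius_pos
    (fun i => hp.mem_env i _ (hσmem i 0 le_rfl))
    (fun i => Set.disjoint_left.2 fun z hz hz' => (hΔ₀.subset hz).2
      (Or.inl (Set.mem_iUnion.2 ⟨i, by simpa only [hq0] using hz'⟩)))
    (fun i j hij t ht u hu => hp.non_overlap i j hij _ (hσmem i t ht) _ (hσmem j u hu))
    (fun i s t hs hst => by
      refine (hp.dist_le i (hσmem i s hs).1 (hσmono i hst) (hσmem i t (hs.trans hst)).2).trans ?_
      rw [mul_assoc]
      exact mul_le_mul_of_nonneg_left (hσsub i s t hst) hV)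
    (by
      -- The factor `b / 2` from the speeds leaves room for `π`: `π b / 2 ≤ 2 b`.
      have h1 := mul_le_mul_of_nonneg_left hsum Real.pi_pos.le
      have h2 : Real.pi * (A.maxRadius * maxSpeed T v * (b / 2)) ≤
          4 * (A.maxRadius * maxSpeed T v * (b / 2)) :=
        mul_le_mul_of_nonneg_right Real.pi_le_four (by positivity)
      linarith)
  refine ⟨Δ, fun i t => p i (σ i t), hΔ, fun i => ⟨σ i, hσ0 i, (hσmono i).monotoneOn _, ?_,
    fun t ht => ⟨hσmem i t ht, rfl⟩⟩, ⟨fun i j hij t ht =>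
      hp.non_overlap i j hij _ (hσmem i t ht) _ (hσmem j t ht), hobs⟩, fun i hi => ?_⟩
  · refine (LipschitzWith.of_le_add fun s t => ?_).lipschitzOnWith
    rcases le_total s t with h | h
    · exact (hσmono i h).trans (le_add_of_nonneg_right dist_nonneg)
    · rw [Real.dist_eq, abs_of_nonneg (sub_nonneg.2 h)]
      have := mul_le_mul_of_nonneg_right (hk1 i) (sub_nonneg.2 h)
      linarith [hσsub i t s h]
  · refine ⟨T / l, by positivity, hlT, fun t ht => ?_⟩
    have hσT : σ i t = T := by
      simp only [hσ, hk, if_pos hi]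
      exact min_eq_right ((div_le_iff₀' hl0).1 ht)
    simp only [hσT, hp.at_dest]
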